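/- Let $\varphi:[0,\infty)\to\mathbb R$ be a positive definite radial function, i.e. $\varphi$ is smooth on $(0,\infty)$ with $(-1)^k\varphi^{(k)}\ge 0$ for all $k\ge 0$, and $\lim_{r\downarrow 0}\varphi(r)=1=\varphi(0)$. Consider a super-Gaussian likelihood for an observation $y_i$ given a latent vector $f_i\in\mathbb R^d$ ($d=1$ for a scalar latent function value), $$p(y_i\mid f_i)=C\,e^{g(y_i)^\top f_i}\,\varphi\big(\|h(f_i,y_i)\|_2^2\big),$$ where $C>0$, $g$ is arbitrary, and $h$ is $\mathbb R^m$-valued and affine in $f_i$, so that $\|h(f_i,y_i)\|_2^2$ is a quadratic polynomial in $f_i$ (for instance $\alpha(y_i)-\beta(y_i)^\top f_i+\gamma(y_i)\|f_i\|_2^2$). Let $f=(f_1,\dots,f_n)$ consist of values of a Gaussian process at given inputs, with law $p(f)$ (possibly degenerate), and let $p(y\mid f)=\prod_i p(y_i\mid f_i)$. The single-block likelihood $C e^{g(y)^\top f}\varphi(\|h(f,y)\|_2^2)$ is the case $n=1$. Then: (1) There is exactly one Borel measure $\pi_\varphi(\cdot\mid 0)$ on $[0,\infty)$, the inverse Laplace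 transform of $\varphi$, with $\int e^{-r\omega}\,\pi_\varphi(d\omega\mid 0)=\varphi(r)$ for all $r>0$. It is a probability measure (not necessarily with a density), and so is each exponential tilting $\pi_\varphi(d\omega\mid c)=e^{-c^2\omega}\,\pi_\varphi(d\omega\mid 0)/\varphi(c^2)$, $c\in\mathbb R$. (2) Put $p(y_i\mid f_i,\omega_i)=C\exp\big(g(y_i)^\top f_i-\|h(f_i,y_i)\|_2^2\,\omega_i\big)$, $p(y\mid f,\omega)=\prod_i p(y_i\mid f_i,\omega_i)$ and $p(d\omega)=\prod_i\pi_\varphi(d\omega_i\mid 0)$. Then $p(y_i\mid f_i)=\int p(y_i\mid f_i,\omega_i)\,\pi_\varphi(d\omega_i\mid 0)$ and $p(y\mid f)=\int p(y\mid f,\omega)\,p(d\omega)$, and integrating $\omega$ out of the augmented model $p(y\mid f,\omega)\,p(df)\,p(d\omega)$ gives the original model $p(y\mid f)\,p(df)$. (3) For given $y$ the augmented model has a well-defined posterior $p(f,\omega\mid y)$ (its total mass in $(f,\omega)$ is finite and positive), and it is conditionally conjugate: the prior $p(f)$ and the complete conditional $p(f\mid\omega,y)$ are Gaussian, and the complete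 conditional $p(\omega\mid f,y)$ is the product $\prod_i\pi_\varphi(\cdot\mid c_i)$ with $c_i=\|h(f_i,y_i)\|_2$, i.e. each $\omega_i$ has an exponential tilting of its prior $\pi_\varphi(\cdot\mid 0)$. -/

import Mathlib

open MeasureTheory ProbabilityTheory Filter Topology
open scoped NNReal ENNReal ContDiff

noncomputable section

/-- `φ` is a positive definite radial function: it is completely monotone
(smooth on `(0, ∞)` with `(-1)^k φ^(k) ≥ 0` for all `k`, and defined at `0` by continuity)
and `φ(r) → 1` as `r ↓ 0`. Only the values of `φ` on `[0, ∞)` matter. -/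
structure IsPDR (φ : ℝ → ℝ) : Prop where
  contDiffOn : ContDiffOn ℝ ∞ φ (Set.Ioi 0)
  alternating : ∀ (k : ℕ) (r : ℝ), 0 < r → 0 ≤ (-1) ^ k * iteratedDeriv k φ r
  tendsto_zero : Tendsto φ (𝓝[>] 0) (𝓝 1)
  map_zero : φ 0 = 1

/-- The Borel measure `μ` on `[0, ∞)` has Laplace transform `φ`:
`∫ exp (-r ω) dμ(ω)` converges and equals `φ(r)`, for every `r > 0`. -/
def HasLaplaceTransform (μ : Measure ℝ≥0) (φ : ℝ → ℝ) : Prop :=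
  ∀ r : ℝ, 0 < r →
    Integrable (fun w : ℝ≥0 => Real.exp (-(r * w))) μ ∧
      ∫ w : ℝ≥0, Real.exp (-(r * w)) ∂μ = φ r

open Classical in
/-- The inverse Laplace transform of `φ`, as a measure on `[0, ∞)`: the measure whose Laplace
transform is `φ` (and `0` if there is none). -/
def inverseLaplace (φ : ℝ → ℝ) : Measure ℝ≥0 :=
  if h : ∃ μ : Measure ℝ≥0, HasLaplaceTransform μ φ then h.choose else 0

/-- The family `π_φ(ω | c) = exp (-c² ω) π_φ(ω | 0) / φ(c²)`: exponential tiltings of the inverse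
Laplace transform of `φ`. -/
def piPhi (φ : ℝ → ℝ) (c : ℝ) : Measure ℝ≥0 :=
  (inverseLaplace φ).withDensity
    (fun w => ENNReal.ofReal (Real.exp (-(c ^ 2 * (w : ℝ))) / φ (c ^ 2)))

/-- A super-Gaussian likelihood (at a fixed value of its hyperparameters) for an observation in `𝒴`
given a latent vector in `ℝ^κ`: `p(y | f) = C exp (g(y)ᵀ f) φ(‖h(f, y)‖²)`, with `h` linear
(affine) in `f`, so that `‖h(f, y)‖²` is a quadratic polynomial in `f`. This includes the isotropic
case `‖h(f, y)‖² = α(y) - β(y)ᵀ f + γ(y) ‖f‖²`, and every case with `κ` a single index. -/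
structure SuperGaussianLikelihood (𝒴 κ : Type*) [Fintype κ] where
  /-- normalizing constant -/
  C : ℝ
  C_pos : 0 < C
  g : 𝒴 → EuclideanSpace ℝ κ
  φ : ℝ → ℝ
  isPDR : IsPDR φ
  /-- dimension of the target of `h` -/
  m : ℕ
  h : 𝒴 → (EuclideanSpace ℝ κ →ᵃ[ℝ] EuclideanSpace ℝ (Fin m))

namespace SuperGaussianLikelihood

variable {𝒴 κ : Type*} [Fintype κ] (L : SuperGaussianLikelihood 𝒴 κ)

/-- `p(y | f) = C exp (g(y)ᵀ f) φ(‖h(f, y)‖²)` -/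
def lik (y : 𝒴) (f : EuclideanSpace ℝ κ) : ℝ :=
  L.C * Real.exp (inner ℝ (L.g y) f) * L.φ (‖L.h y f‖ ^ 2)

/-- `p(y | f, ω) = C exp (g(y)ᵀ f - ‖h(f, y)‖² ω)` -/
def augLik (y : 𝒴) (f : EuclideanSpace ℝ κ) (w : ℝ≥0) : ℝ :=
  L.C * Real.exp (inner ℝ (L.g y) f - ‖L.h y f‖ ^ 2 * w)

end SuperGaussianLikelihood

section Model

variable {𝒴 ι κ : Type*} [Fintype ι] [Fintype κ]

/-- The block `fᵢ ∈ ℝ^κ` of the vector of all latent values. -/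
def block (f : EuclideanSpace ℝ (ι × κ)) (i : ι) : EuclideanSpace ℝ κ :=
  WithLp.toLp 2 (fun k => f (i, k))

/-- The likelihood `p(y | f) = ∏ᵢ p(yᵢ | fᵢ)` of all observations. -/
def fullLik (L : SuperGaussianLikelihood 𝒴 κ) (y : ι → 𝒴) (f : EuclideanSpace ℝ (ι × κ)) : ℝ :=
  ∏ i, L.lik (y i) (block f i)

/-- The augmented likelihood `p(y | f, ω) = ∏ᵢ p(yᵢ | fᵢ, ωᵢ)`. -/
def fullAugLik (L : SuperGaussianLikelihood 𝒴 κ) (y : ι → 𝒴) (f : EuclideanSpace ℝ (ι × κ))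
    (w : ι → ℝ≥0) : ℝ :=
  ∏ i, L.augLik (y i) (block f i) (w i)

/-- The prior `p(f)`: the joint law of the values `f_j = F (x j)` of the process `F` at the
inputs `x j`. -/
def gpPrior {T Ω : Type*} [MeasurableSpace Ω] (F : T → Ω → ℝ) (P : Measure Ω) (x : ι × κ → T) :
    Measure (EuclideanSpace ℝ (ι × κ)) :=
  P.map (fun a => WithLp.toLp 2 (fun j => F (x j) a))

/-- The prior `p(ω) = ∏ᵢ π_φ(ωᵢ | 0)` of the auxiliary variables. -/
def auxPrior (ι : Type*) [Fintype ι] (φ : ℝ → ℝ) : Measure (ι → ℝ≥0) :=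
  Measure.pi (fun _ => piPhi φ 0)

/-- The original model `p(y, f) = p(y | f) p(f)`, for given data `y`, as a measure in `f`. -/
def modelJoint (L : SuperGaussianLikelihood 𝒴 κ) (prior : Measure (EuclideanSpace ℝ (ι × κ)))
    (y : ι → 𝒴) : Measure (EuclideanSpace ℝ (ι × κ)) :=
  prior.withDensity (fun f => ENNReal.ofReal (fullLik L y f))

/-- The augmented model `p(y, f, ω) = p(y | f, ω) p(f) p(ω)`, for given data `y`, as a measure
in `(f, ω)`. -/
def augJoint (L : SuperGaussianLikelihood 𝒴 κ) (prior : Measure (EuclideanSpace ℝ (ι × κ)))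
    (y : ι → 𝒴) : Measure (EuclideanSpace ℝ (ι × κ) × (ι → ℝ≥0)) :=
  (prior.prod (auxPrior ι L.φ)).withDensity
    (fun p => ENNReal.ofReal (fullAugLik L y p.1 p.2))

/-- The posterior `p(f, ω | y) = p(y, f, ω) / p(y)` of the augmented model. -/
def augPosterior (L : SuperGaussianLikelihood 𝒴 κ) (prior : Measure (EuclideanSpace ℝ (ι × κ)))
    (y : ι → 𝒴) : Measure (EuclideanSpace ℝ (ι × κ) × (ι → ℝ≥0)) :=
  (augJoint L prior y Set.univ)⁻¹ • augJoint L prior y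

end Model

end

/-!
Existence of the inverse Laplace transform is Bernstein's theorem. If `φ ≤ 1`, expand `φ` in its
Taylor series at a large `s`: the terms at `0` are nonnegative with sum at most `1`. Put them as
masses on the points `exp (-k / s)` of `[0, 1]`, and the missing mass on `0`. The moment of order
`r` of this probability measure is `φ (s - s * exp (-r / s))`, which tends to `φ r` as `s → ∞`,
so compactness of the space of probability measures on `[0, 1]` gives a measure with moments
`φ r`, and `ω = -log x` carries it to `[0, ∞)`. Rescaling, shifting and exponential reweighting
remove the bound on `φ`. Uniqueness holds because the integrals of the powers of `exp (-ω)`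
determine a finite measure.

The rest is exponential tilting. The augmented posterior is the tilting of `p(df) p(dω)` by the
augmented log-likelihood, so its complete conditionals are the priors tilted by the sections of
the log-likelihood. In `ω` these are sums of affine functions of the `ωᵢ`, which tilt each factor
separately. In `f` they are sums of affine functions and of functions `-a (ℓ f + b) ^ 2` with
linear `ℓ`. A tilting by a function of `ℓ` keeps a Gaussian measure, even a degenerate one,
Gaussian as soon as it does so on the line, because any other linear form is a multiple of `ℓ`
plus a form independent of `ℓ`; on the line, one completes the square.
-/

/-! ### Completely monotone functions -/

/-- `φ` is completely monotone on `(0, ∞)`; its values on `(-∞, 0]` are irrelevant. -/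
structure IsCompletelyMonotone (φ : ℝ → ℝ) : Prop where
  contDiffOn : ContDiffOn ℝ ∞ φ (Set.Ioi 0)
  alternating : ∀ (k : ℕ) (r : ℝ), 0 < r → 0 ≤ (-1) ^ k * iteratedDeriv k φ r

/-- The `k`-th term of the Taylor series of `φ` at `s`, evaluated at `s - y`. The sign of `(-y) ^ k`
is attached to the derivative, so that the term is nonnegative for completely monotone `φ`. -/
noncomputable def taylorTerm (φ : ℝ → ℝ) (s : ℝ) (k : ℕ) (y : ℝ) : ℝ :=
  (k.factorial : ℝ)⁻¹ * ((-1) ^ k * iteratedDeriv k φ s) * y ^ k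

/-- The integral form of the remainder of order `n` of the Taylor series of `φ` at `s`, evaluated at
`s - y`, with signs distributed as in `taylorTerm`. -/
noncomputable def taylorRemainder (φ : ℝ → ℝ) (s : ℝ) (n : ℕ) (y : ℝ) : ℝ :=
  y ^ (n + 1) * ((n.factorial : ℝ)⁻¹ *
    ∫ t in (0 : ℝ)..1, (1 - t) ^ n * ((-1) ^ (n + 1) * iteratedDeriv (n + 1) φ (s - t * y)))

lemma taylorTerm_mul (φ : ℝ → ℝ) (s : ℝ) (k : ℕ) (y u : ℝ) :
    taylorTerm φ s k (y * u) = taylorTerm φ s k y * u ^ k := by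
  simp only [taylorTerm, mul_pow, mul_assoc]

namespace IsCompletelyMonotone

variable {φ : ℝ → ℝ}

lemma contDiffAt (hφ : IsCompletelyMonotone φ) {r : ℝ} (hr : 0 < r) (n : ℕ) :
    ContDiffAt ℝ n φ r :=
  (hφ.contDiffOn.contDiffAt (Ioi_mem_nhds hr)).of_le (by exact_mod_cast le_top)

lemma nonneg (hφ : IsCompletelyMonotone φ) {r : ℝ} (hr : 0 < r) : 0 ≤ φ r := by
  simpa using hφ.alternating 0 r hr

lemma hasDerivAt_iteratedDeriv (hφ : IsCompletelyMonotone φ) (k : ℕ) {r : ℝ} (hr : 0 < r) :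
    HasDerivAt (iteratedDeriv k φ) (iteratedDeriv (k + 1) φ r) r := by
  rw [iteratedDeriv_succ]
  refine DifferentiableAt.hasDerivAt ?_
  rw [iteratedDeriv_eq_equiv_comp, LinearIsometryEquiv.comp_differentiableAt_iff]
  exact (hφ.contDiffAt hr (k + 1)).differentiableAt_iteratedFDeriv
    (by exact_mod_cast Nat.lt_succ_self k)

lemma antitoneOn_iteratedDeriv (hφ : IsCompletelyMonotone φ) (k : ℕ) :
    AntitoneOn (fun r => (-1) ^ k * iteratedDeriv k φ r) (Set.Ioi 0) := by
  have hderiv : ∀ r ∈ Set.Ioi (0 : ℝ), HasDerivAt (fun r => (-1) ^ k * iteratedDeriv k φ r)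
      ((-1) ^ k * iteratedDeriv (k + 1) φ r) r := fun r hr =>
    (hφ.hasDerivAt_iteratedDeriv k hr).const_mul _
  refine antitoneOn_of_deriv_nonpos (convex_Ioi 0)
    (fun r hr => (hderiv r hr).continuousAt.continuousWithinAt)
    (fun r hr => (hderiv r (interior_subset hr)).differentiableAt.differentiableWithinAt)
    fun r hr => ?_
  rw [interior_Ioi] at hr
  rw [(hderiv r hr).deriv]
  have := hφ.alternating (k + 1) r hr
  rw [pow_succ] at this
  linarith

lemma antitoneOn (hφ : IsCompletelyMonotone φ) : AntitoneOn φ (Set.Ioi 0) := by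
  simpa using hφ.antitoneOn_iteratedDeriv 0

lemma comp_add_const (hφ : IsCompletelyMonotone φ) {a : ℝ} (ha : 0 ≤ a) :
    IsCompletelyMonotone fun r => φ (r + a) where
  contDiffOn := hφ.contDiffOn.comp (by fun_prop) fun _ hr => add_pos_of_pos_of_nonneg hr ha
  alternating k r hr := by
    rw [iteratedDeriv_comp_add_const]
    exact hφ.alternating k _ (by positivity)

lemma const_mul (hφ : IsCompletelyMonotone φ) {a : ℝ} (ha : 0 ≤ a) :
    IsCompletelyMonotone fun r => a * φ r where
  contDiffOn := contDiffOn_const.mul hφ.contDiffOn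
  alternating k r hr := by
    rw [iteratedDeriv_const_mul_field, mul_left_comm]
    exact mul_nonneg ha (hφ.alternating k r hr)

lemma taylorTerm_nonneg (hφ : IsCompletelyMonotone φ) {s y : ℝ} (hs : 0 < s) (hy : 0 ≤ y) (k : ℕ) :
    0 ≤ taylorTerm φ s k y :=
  mul_nonneg (mul_nonneg (by positivity) (hφ.alternating k s hs)) (pow_nonneg hy k)

lemma eq_sum_taylorTerm_add_taylorRemainder (hφ : IsCompletelyMonotone φ) {s y : ℝ} (hy : 0 ≤ y)
    (hys : y < s) (n : ℕ) :
    φ (s - y) = ∑ k ∈ Finset.range (n + 1), taylorTerm φ s k y + taylorRemainder φ s n y := by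
  have hsmooth : ∀ t ∈ Set.Icc (0 : ℝ) 1, ContDiffAt ℝ (n + 1) φ (s + t • -y) := by
    intro t ht
    refine hφ.contDiffAt ?_ (n + 1)
    have : t * y ≤ y := mul_le_of_le_one_left hy ht.2
    simp only [smul_eq_mul]
    linarith
  have htaylor := map_add_eq_sum_add_integral_iteratedFDeriv hsmooth
  rw [← sub_eq_add_neg] at htaylor
  rw [htaylor, taylorRemainder]
  simp only [taylorTerm, iteratedFDeriv_apply_eq_iteratedDeriv_mul_prod, Finset.prod_const,
    Finset.card_univ, Fintype.card_fin, smul_eq_mul, neg_pow y]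
  congr 1
  · exact Finset.sum_congr rfl fun k _ => by ring
  · rw [mul_left_comm]
    refine congrArg (fun z : ℝ => (n.factorial : ℝ)⁻¹ * z) ?_
    rw [← intervalIntegral.integral_const_mul]
    refine intervalIntegral.integral_congr fun t _ => ?_
    rw [mul_neg, ← sub_eq_add_neg]
    ring

section Remainder

variable {s y b : ℝ}

lemma intervalIntegrable_taylorRemainder (hφ : IsCompletelyMonotone φ) (hy : 0 ≤ y) (hys : y < s)
    (n : ℕ) :
    IntervalIntegrable
      (fun t => (1 - t) ^ n * ((-1) ^ (n + 1) * iteratedDeriv (n + 1) φ (s - t * y)))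
      volume 0 1 := by
  refine ContinuousOn.intervalIntegrable ?_
  rw [Set.uIcc_of_le zero_le_one]
  refine ContinuousOn.mul (by fun_prop) (ContinuousOn.mul continuousOn_const fun t ht => ?_)
  have hpos : 0 < s - t * y := by linarith [mul_le_of_le_one_left hy ht.2]
  exact ((hφ.hasDerivAt_iteratedDeriv (n + 1) hpos).continuousAt.comp
    (f := fun t => s - t * y) (by fun_prop)).continuousWithinAt

lemma taylorRemainder_nonneg (hφ : IsCompletelyMonotone φ) (hy : 0 ≤ y) (hys : y < s) (n : ℕ) :
    0 ≤ taylorRemainder φ s n y := by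
  refine mul_nonneg (by positivity) (mul_nonneg (by positivity) ?_)
  refine intervalIntegral.integral_nonneg zero_le_one fun t ht => ?_
  refine mul_nonneg (pow_nonneg (by linarith [ht.2]) n) (hφ.alternating _ _ ?_)
  linarith [mul_le_of_le_one_left hy ht.2]

lemma taylorRemainder_le (hφ : IsCompletelyMonotone φ) (hy : 0 ≤ y) (hys : y < s) (n : ℕ) :
    taylorRemainder φ s n y ≤ φ (s - y) := by
  have hsum := Finset.sum_nonneg fun k (_ : k ∈ Finset.range (n + 1)) =>
    hφ.taylorTerm_nonneg (hy.trans_lt hys) hy k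
  linarith [hφ.eq_sum_taylorTerm_add_taylorRemainder hy hys n]

lemma pow_mul_taylorRemainder_le (hφ : IsCompletelyMonotone φ) (hy : 0 ≤ y) (hyb : y ≤ b)
    (hbs : b < s) (n : ℕ) :
    b ^ (n + 1) * taylorRemainder φ s n y ≤ y ^ (n + 1) * taylorRemainder φ s n b := by
  have hb : 0 ≤ b := hy.trans hyb
  have hint : (∫ t in (0 : ℝ)..1,
        (1 - t) ^ n * ((-1) ^ (n + 1) * iteratedDeriv (n + 1) φ (s - t * y)))
      ≤ ∫ t in (0 : ℝ)..1,
        (1 - t) ^ n * ((-1) ^ (n + 1) * iteratedDeriv (n + 1) φ (s - t * b)) := by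
    refine intervalIntegral.integral_mono_on zero_le_one
      (hφ.intervalIntegrable_taylorRemainder hy (hyb.trans_lt hbs) n)
      (hφ.intervalIntegrable_taylorRemainder hb hbs n) fun t ht => ?_
    have hty : t * y ≤ t * b := mul_le_mul_of_nonneg_left hyb ht.1
    have htb : t * b ≤ b := mul_le_of_le_one_left hb ht.2
    refine mul_le_mul_of_nonneg_left ?_ (pow_nonneg (by linarith [ht.2]) n)
    exact hφ.antitoneOn_iteratedDeriv (n + 1) (Set.mem_Ioi.2 (by linarith))
      (Set.mem_Ioi.2 (by linarith)) (by linarith)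
  have hcoeff : 0 ≤ b ^ (n + 1) * y ^ (n + 1) * (n.factorial : ℝ)⁻¹ := by positivity
  unfold taylorRemainder
  linarith [mul_le_mul_of_nonneg_left hint hcoeff]

lemma tendsto_taylorRemainder (hφ : IsCompletelyMonotone φ) (hy : 0 ≤ y) (hys : y < s) :
    Tendsto (fun n => taylorRemainder φ s n y) atTop (𝓝 0) := by
  obtain ⟨b, hyb, hbs⟩ := exists_between hys
  have hb : 0 < b := hy.trans_lt hyb
  have hbound : ∀ n, taylorRemainder φ s n y ≤ (y / b) ^ (n + 1) * φ (s - b) := fun n => by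
    have hmono := hφ.pow_mul_taylorRemainder_le hy hyb.le hbs n
    have hle := mul_le_mul_of_nonneg_left (hφ.taylorRemainder_le hb.le hbs n)
      (pow_nonneg hy (n + 1))
    rw [div_pow, div_mul_eq_mul_div, le_div_iff₀ (by positivity)]
    linarith
  refine squeeze_zero (hφ.taylorRemainder_nonneg hy hys) hbound ?_
  have hgeom : Tendsto (fun n : ℕ => (y / b) ^ (n + 1)) atTop (𝓝 0) :=
    (tendsto_pow_atTop_nhds_zero_of_lt_one (by positivity) ((div_lt_one hb).2 hyb)).comp
      (tendsto_add_atTop_nat 1)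
  simpa using hgeom.mul_const (φ (s - b))

end Remainder

lemma hasSum_taylorTerm (hφ : IsCompletelyMonotone φ) {s y : ℝ} (hy : 0 ≤ y) (hys : y < s) :
    HasSum (fun k => taylorTerm φ s k y) (φ (s - y)) := by
  rw [hasSum_iff_tendsto_nat_of_nonneg (hφ.taylorTerm_nonneg (hy.trans_lt hys) hy),
    ← tendsto_add_atTop_iff_nat 1]
  have hpartial : (fun n => ∑ k ∈ Finset.range (n + 1), taylorTerm φ s k y)
      = fun n => φ (s - y) - taylorRemainder φ s n y :=
    funext fun n => eq_sub_of_add_eq (hφ.eq_sum_taylorTerm_add_taylorRemainder hy hys n).symm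
  rw [hpartial]
  simpa using (hφ.tendsto_taylorRemainder hy hys).const_sub (φ (s - y))

end IsCompletelyMonotone

/-! ### Bernstein's theorem -/

/-- The point `exp (-x)` of the unit interval, for `0 ≤ x`. -/
noncomputable def expNegPoint (x : ℝ≥0) : unitInterval :=
  ⟨Real.exp (-x), (Real.exp_pos _).le, Real.exp_le_one_iff.2 (by simp)⟩

/-- The discrete approximation at scale `s` of the measure with moments `∫ t ^ r = φ r` on the unit
interval: it has mass `(-s) ^ k φ⁽ᵏ⁾(s) / k!` at `exp (-k / s)`, and the mass missing from `1`
at `0`. -/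
noncomputable def bernsteinApprox (φ : ℝ → ℝ) (s : ℝ≥0) : Measure unitInterval :=
  (Measure.sum fun k : ℕ =>
      ENNReal.ofReal (taylorTerm φ s k s) • Measure.dirac (expNegPoint (k / s))) +
    ENNReal.ofReal (1 - ∑' k, taylorTerm φ s k s) • Measure.dirac 0

lemma expNegPoint_rpow (x : ℝ≥0) (r : ℝ) : (expNegPoint x : ℝ) ^ r = Real.exp (-(x * r)) := by
  rw [expNegPoint, ← Real.exp_mul, neg_mul]

lemma continuous_unitInterval_rpow {r : ℝ} (hr : 0 ≤ r) :
    Continuous fun t : unitInterval => (t : ℝ) ^ r :=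
  (Real.continuous_rpow_const hr).comp continuous_subtype_val

lemma integrable_unitInterval_rpow {r : ℝ} (hr : 0 ≤ r) (μ : Measure unitInterval)
    [IsFiniteMeasure μ] : Integrable (fun t : unitInterval => (t : ℝ) ^ r) μ :=
  (continuous_unitInterval_rpow hr).integrable_of_hasCompactSupport (.of_compactSpace _)

lemma tendsto_sub_mul_exp_neg_div (r : ℝ) :
    Tendsto (fun s : ℝ => s - s * Real.exp (-(r / s))) atTop (𝓝 r) := by
  have hderiv : HasDerivAt (fun x : ℝ => -Real.exp (-(r * x))) r 0 := by
    refine (((hasDerivAt_id (0 : ℝ)).const_mul r).neg.exp).neg.congr_deriv ?_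
    simp
  refine (hderiv.tendsto_slope_zero_right.comp tendsto_inv_atTop_nhdsGT_zero).congr fun s => ?_
  simp only [Function.comp_apply, zero_add, inv_inv, smul_eq_mul, mul_zero, neg_zero,
    Real.exp_zero, div_eq_mul_inv]
  ring

namespace IsCompletelyMonotone

variable {φ : ℝ → ℝ}

lemma hasSum_taylorTerm_mul_pow (hφ : IsCompletelyMonotone φ) {s u : ℝ} (hs : 0 < s) (hu₀ : 0 ≤ u)
    (hu₁ : u < 1) : HasSum (fun k => taylorTerm φ s k s * u ^ k) (φ (s - s * u)) := by
  simpa only [taylorTerm_mul] using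
    hφ.hasSum_taylorTerm (mul_nonneg hs.le hu₀) (mul_lt_of_lt_one_right hs hu₁)

lemma sum_taylorTerm_le (hφ : IsCompletelyMonotone φ) {M : ℝ} (hM : ∀ r, 0 < r → φ r ≤ M)
    {s : ℝ} (hs : 0 < s) (n : ℕ) : ∑ k ∈ Finset.range n, taylorTerm φ s k s ≤ M := by
  have hlim : Tendsto (fun u : ℝ => ∑ k ∈ Finset.range n, taylorTerm φ s k s * u ^ k) (𝓝[<] 1)
      (𝓝 (∑ k ∈ Finset.range n, taylorTerm φ s k s * 1 ^ k)) :=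
    (Continuous.tendsto (by fun_prop) 1).mono_left nhdsWithin_le_nhds
  simp only [one_pow, mul_one] at hlim
  refine le_of_tendsto hlim ?_
  filter_upwards [Ioo_mem_nhdsLT (zero_lt_one (α := ℝ))] with u hu
  refine (sum_le_hasSum _
    (fun k _ => mul_nonneg (hφ.taylorTerm_nonneg hs hs.le k) (pow_nonneg hu.1.le k))
    (hφ.hasSum_taylorTerm_mul_pow hs hu.1.le hu.2)).trans (hM _ ?_)
  exact sub_pos.2 (mul_lt_of_lt_one_right hs hu.2)

lemma summable_taylorTerm (hφ : IsCompletelyMonotone φ) {M : ℝ}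
    (hM : ∀ r, 0 < r → φ r ≤ M) {s : ℝ} (hs : 0 < s) : Summable fun k => taylorTerm φ s k s :=
  summable_of_sum_range_le (hφ.taylorTerm_nonneg hs hs.le) (hφ.sum_taylorTerm_le hM hs)

lemma isProbabilityMeasure_bernsteinApprox (hφ : IsCompletelyMonotone φ)
    (hle : ∀ r, 0 < r → φ r ≤ 1) {s : ℝ≥0} (hs : 0 < s) :
    IsProbabilityMeasure (bernsteinApprox φ s) where
  measure_univ := by
    have hnonneg := hφ.taylorTerm_nonneg (NNReal.coe_pos.2 hs) s.coe_nonneg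
    have hsum := hφ.summable_taylorTerm hle (NNReal.coe_pos.2 hs)
    have htsum : ∑' k, taylorTerm φ s k s ≤ 1 :=
      hsum.tsum_le_of_sum_range_le (hφ.sum_taylorTerm_le hle (NNReal.coe_pos.2 hs))
    simp only [bernsteinApprox, Measure.add_apply, Measure.sum_apply _ MeasurableSet.univ,
      Measure.smul_apply, measure_univ, smul_eq_mul, mul_one]
    rw [← ENNReal.ofReal_tsum_of_nonneg hnonneg hsum,
      ← ENNReal.ofReal_add (tsum_nonneg hnonneg) (sub_nonneg.2 htsum), add_sub_cancel,
      ENNReal.ofReal_one]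

lemma integral_rpow_bernsteinApprox (hφ : IsCompletelyMonotone φ) (hle : ∀ r, 0 < r → φ r ≤ 1)
    {s : ℝ≥0} (hs : 0 < s) {r : ℝ} (hr : 0 < r) :
    ∫ t : unitInterval, (t : ℝ) ^ r ∂bernsteinApprox φ s = φ (s - s * Real.exp (-(r / s))) := by
  have hs' : (0 : ℝ) < s := hs
  have := hφ.isProbabilityMeasure_bernsteinApprox hle hs
  have hint := integrable_add_measure.1 (integrable_unitInterval_rpow hr.le (bernsteinApprox φ s))
  have hlt : Real.exp (-(r / s)) < 1 := Real.exp_lt_one_iff.2 (neg_neg_of_pos (by positivity))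
  rw [bernsteinApprox, integral_add_measure hint.1 hint.2, integral_smul_measure, integral_dirac,
    Set.Icc.coe_zero, Real.zero_rpow hr.ne', smul_zero, add_zero]
  refine (hasSum_integral_measure hint.1).unique
    ((hφ.hasSum_taylorTerm_mul_pow hs' (Real.exp_pos _).le hlt).congr_fun fun k => ?_)
  rw [integral_smul_measure, integral_dirac, expNegPoint_rpow,
    ENNReal.toReal_ofReal (hφ.taylorTerm_nonneg hs' hs'.le k), smul_eq_mul, ← Real.exp_nat_mul]
  push_cast
  congr 2
  ring

lemma exists_measure_unitInterval (hφ : IsCompletelyMonotone φ) (hle : ∀ r, 0 < r → φ r ≤ 1) :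
    ∃ μ : ProbabilityMeasure unitInterval, ∀ r : ℝ, 0 < r →
      ∫ t : unitInterval, (t : ℝ) ^ r ∂(μ : Measure unitInterval) = φ r := by
  let s : ℕ → ℝ≥0 := fun n => n + 1
  have hs : ∀ n, 0 < s n := fun n => by positivity
  let ν : ℕ → ProbabilityMeasure unitInterval := fun n =>
    ⟨bernsteinApprox φ (s n), hφ.isProbabilityMeasure_bernsteinApprox hle (hs n)⟩
  obtain ⟨μ, a, ha, hμ⟩ := CompactSpace.tendsto_subseq ν
  refine ⟨μ, fun r hr => ?_⟩
  have hweak := ProbabilityMeasure.tendsto_iff_forall_integral_tendsto.1 hμ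
    (.mkOfCompact ⟨_, continuous_unitInterval_rpow hr.le⟩)
  have hs_atTop : Tendsto (fun n => (s n : ℝ)) atTop atTop := by
    simpa [s] using tendsto_atTop_add_const_right _ (1 : ℝ) tendsto_natCast_atTop_atTop
  refine tendsto_nhds_unique hweak ?_
  refine ((hφ.contDiffAt hr 0).continuousAt.tendsto.comp
    ((tendsto_sub_mul_exp_neg_div r).comp (hs_atTop.comp ha.tendsto_atTop))).congr fun n => ?_
  exact (hφ.integral_rpow_bernsteinApprox hle (hs (a n)) hr).symm

end IsCompletelyMonotone

lemma hasLaplaceTransform_map_neg_log {φ : ℝ → ℝ} {μ : Measure unitInterval} [IsFiniteMeasure μ]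
    (h : ∀ r : ℝ, 0 < r → ∫ t : unitInterval, (t : ℝ) ^ r ∂μ = φ r) :
    HasLaplaceTransform
      ((μ.restrict {0}ᶜ).map fun t : unitInterval => (-Real.log t).toNNReal) φ := by
  intro r hr
  have hmeas : Measurable fun t : unitInterval => (-Real.log t).toNNReal := by fun_prop
  have hcont : Continuous fun w : ℝ≥0 => Real.exp (-(r * w)) := by fun_prop
  have hexp : ∀ t ∈ ({0}ᶜ : Set unitInterval),
      Real.exp (-(r * (-Real.log t).toNNReal)) = (t : ℝ) ^ r := by
    intro t ht
    have ht₀ : (0 : ℝ) < t := unitInterval.pos_iff_ne_zero.2 ht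
    rw [Real.coe_toNNReal _ (neg_nonneg.2 (Real.log_nonpos ht₀.le t.2.2)),
      Real.rpow_def_of_pos ht₀]
    ring_nf
  have hset : MeasurableSet ({0}ᶜ : Set unitInterval) := (measurableSet_singleton _).compl
  constructor
  · rw [integrable_map_measure hcont.aestronglyMeasurable hmeas.aemeasurable]
    refine (integrable_unitInterval_rpow hr.le (μ.restrict {0}ᶜ)).congr ?_
    filter_upwards [ae_restrict_mem hset] with t ht using (hexp t ht).symm
  · rw [integral_map hmeas.aemeasurable hcont.aestronglyMeasurable,
      setIntegral_congr_fun hset hexp, setIntegral_eq_integral_of_forall_compl_eq_zero, h r hr]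
    intro t ht
    rw [Set.notMem_compl_iff, Set.mem_singleton_iff] at ht
    simp [ht, Real.zero_rpow hr.ne']

/-- The measure `exp (-a ω) μ(dω)` on `[0, ∞)`, whose Laplace transform is that of `μ` shifted
by `a`; `a` may be negative. -/
noncomputable def expWeight (a : ℝ) (μ : Measure ℝ≥0) : Measure ℝ≥0 :=
  μ.withDensity fun w => ENNReal.ofReal (Real.exp (-(a * w)))

section ExpWeight

variable {μ : Measure ℝ≥0}

lemma expWeight_zero : expWeight 0 μ = μ := by simp [expWeight]

lemma expWeight_expWeight (a b : ℝ) : expWeight b (expWeight a μ) = expWeight (a + b) μ := by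
  rw [expWeight, expWeight, expWeight, ← withDensity_mul _ (by fun_prop) (by fun_prop)]
  congr 1 with w
  rw [Pi.mul_apply, ← ENNReal.ofReal_mul (Real.exp_pos _).le, ← Real.exp_add]
  ring_nf

lemma expWeight_injective (a : ℝ) : Function.Injective (expWeight a) :=
  Function.LeftInverse.injective (g := expWeight (-a)) fun μ => by
    rw [expWeight_expWeight, add_neg_cancel, expWeight_zero]

lemma integrable_exp_expWeight_iff (a r : ℝ) :
    Integrable (fun w : ℝ≥0 => Real.exp (-(r * w))) (expWeight a μ) ↔
      Integrable (fun w : ℝ≥0 => Real.exp (-((r + a) * w))) μ := by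
  rw [expWeight, integrable_withDensity_iff_integrable_smul' (by fun_prop) (by simp)]
  refine integrable_congr (Eventually.of_forall fun w => ?_)
  simp only [smul_eq_mul, ENNReal.toReal_ofReal (Real.exp_pos _).le]
  rw [← Real.exp_add]
  ring_nf

lemma integral_exp_expWeight (a r : ℝ) :
    ∫ w : ℝ≥0, Real.exp (-(r * w)) ∂expWeight a μ
      = ∫ w : ℝ≥0, Real.exp (-((r + a) * w)) ∂μ := by
  rw [expWeight, integral_withDensity_eq_integral_toReal_smul (by fun_prop) (by simp)]
  refine integral_congr_ae (Eventually.of_forall fun w => ?_)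
  simp only [smul_eq_mul, ENNReal.toReal_ofReal (Real.exp_pos _).le]
  rw [← Real.exp_add]
  ring_nf

lemma isFiniteMeasure_expWeight {a : ℝ}
    (h : Integrable (fun w : ℝ≥0 => Real.exp (-(a * w))) μ) : IsFiniteMeasure (expWeight a μ) :=
  isFiniteMeasure_withDensity_ofReal h.2

end ExpWeight

/-- `w ↦ exp (-w)` as a bounded continuous function on `[0, ∞)`; the algebra it generates
separates points. -/
noncomputable def expNegBCF : BoundedContinuousFunction ℝ≥0 ℝ :=
  .ofNormedAddCommGroup (fun w => Real.exp (-w)) (by fun_prop) 1 fun w => by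
    rw [Real.norm_of_nonneg (Real.exp_pos _).le]
    exact Real.exp_le_one_iff.2 (by simp)

lemma expNegBCF_pow_apply (k : ℕ) (w : ℝ≥0) : (expNegBCF ^ k) w = Real.exp (-(k * w)) := by
  rw [BoundedContinuousFunction.coe_pow, Pi.pow_apply, ← mul_neg, Real.exp_nat_mul]
  rfl

lemma ext_of_integral_exp_neg_nat_mul {μ ν : Measure ℝ≥0} [IsFiniteMeasure μ] [IsFiniteMeasure ν]
    (h : ∀ k : ℕ, ∫ w : ℝ≥0, Real.exp (-(k * w)) ∂μ = ∫ w : ℝ≥0, Real.exp (-(k * w)) ∂ν) :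
    μ = ν := by
  let A : StarSubalgebra ℝ (BoundedContinuousFunction ℝ≥0 ℝ) :=
    { Algebra.adjoin ℝ {expNegBCF} with
      star_mem' := fun {a} ha => by
        have : star a = a := by ext w; simp
        rwa [this] }
  refine ext_of_forall_mem_subalgebra_integral_eq_of_polish (𝕜 := ℝ) (A := A) ?_ fun g hg => ?_
  · intro x y hxy
    refine ⟨expNegBCF, ⟨_, ⟨_, Algebra.self_mem_adjoin_singleton ℝ expNegBCF, rfl⟩, rfl⟩, ?_⟩
    simpa [expNegBCF] using hxy
  obtain ⟨p, rfl⟩ : ∃ p : Polynomial ℝ, Polynomial.aeval expNegBCF p = g := by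
    have hg' : g ∈ Algebra.adjoin ℝ {expNegBCF} := hg
    rwa [Algebra.adjoin_singleton_eq_range_aeval] at hg'
  clear hg
  induction p using Polynomial.induction_on' with
  | add p q hp hq =>
    simp only [map_add, BoundedContinuousFunction.coe_add, Pi.add_apply]
    rw [integral_add (BoundedContinuousFunction.integrable _ _)
        (BoundedContinuousFunction.integrable _ _), hp, hq,
      integral_add (BoundedContinuousFunction.integrable _ _)
        (BoundedContinuousFunction.integrable _ _)]
  | monomial k c =>
    simp only [Polynomial.aeval_monomial, ← Algebra.smul_def, BoundedContinuousFunction.coe_smul,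
      expNegBCF_pow_apply, integral_smul, h k]

namespace HasLaplaceTransform

variable {φ ψ : ℝ → ℝ} {μ ν : Measure ℝ≥0}

lemma congr (hμ : HasLaplaceTransform μ φ) (h : ∀ r, 0 < r → φ r = ψ r) :
    HasLaplaceTransform μ ψ := fun r hr => h r hr ▸ hμ r hr

lemma smul (hμ : HasLaplaceTransform μ φ) (c : ℝ≥0) :
    HasLaplaceTransform (c • μ) fun r => c * φ r := fun r hr =>
  ⟨(hμ r hr).1.smul_measure_nnreal, by
    rw [integral_smul_nnreal_measure, (hμ r hr).2, NNReal.smul_def, smul_eq_mul]⟩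

lemma expWeight (hμ : HasLaplaceTransform μ φ) {a : ℝ} (ha : 0 ≤ a) :
    HasLaplaceTransform (expWeight a μ) fun r => φ (r + a) := fun r hr => by
  rw [integrable_exp_expWeight_iff, integral_exp_expWeight]
  exact hμ (r + a) (by positivity)

protected lemma unique (hμ : HasLaplaceTransform μ φ) (hν : HasLaplaceTransform ν φ) : μ = ν := by
  have := isFiniteMeasure_expWeight (hμ 1 one_pos).1
  have := isFiniteMeasure_expWeight (hν 1 one_pos).1
  refine expWeight_injective 1 (ext_of_integral_exp_neg_nat_mul fun k => ?_)
  rw [integral_exp_expWeight, integral_exp_expWeight, (hμ _ (by positivity)).2,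
    (hν _ (by positivity)).2]

lemma measure_univ_eq {c : ℝ} (hμ : HasLaplaceTransform μ φ) (hc : Tendsto φ (𝓝[>] 0) (𝓝 c)) :
    μ Set.univ = ENNReal.ofReal c := by
  let r : ℕ → ℝ := fun n => ((n : ℝ) + 1)⁻¹
  have hr : ∀ n, 0 < r n := fun n => by positivity
  have hr_lim : Tendsto r atTop (𝓝[>] 0) := tendsto_inv_atTop_nhdsGT_zero.comp
    (tendsto_atTop_add_const_right _ (1 : ℝ) tendsto_natCast_atTop_atTop)
  have hmono : Tendsto (fun n => ∫⁻ w : ℝ≥0, ENNReal.ofReal (Real.exp (-(r n * w))) ∂μ)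
      atTop (𝓝 (∫⁻ _, 1 ∂μ)) := by
    refine lintegral_tendsto_of_tendsto_of_monotone (fun n => by fun_prop)
      (Eventually.of_forall fun w n m hnm => ?_) (Eventually.of_forall fun w => ?_)
    · dsimp only [r]
      gcongr
    · simpa [Function.comp_def] using ENNReal.tendsto_ofReal ((Real.continuous_exp.tendsto _).comp
        ((tendsto_nhds_of_tendsto_nhdsWithin hr_lim).mul_const (w : ℝ)).neg)
  rw [lintegral_one] at hmono
  refine tendsto_nhds_unique hmono ((ENNReal.tendsto_ofReal (hc.comp hr_lim)).congr fun n => ?_)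
  rw [Function.comp_apply, ← (hμ _ (hr n)).2, ofReal_integral_eq_lintegral_ofReal (hμ _ (hr n)).1
    (Eventually.of_forall fun _ => (Real.exp_pos _).le)]

end HasLaplaceTransform

namespace IsCompletelyMonotone

variable {φ : ℝ → ℝ}

lemma exists_hasLaplaceTransform_of_le (hφ : IsCompletelyMonotone φ) {M : ℝ}
    (hM : ∀ r, 0 < r → φ r ≤ M) : ∃ μ : Measure ℝ≥0, HasLaplaceTransform μ φ := by
  have hpos : 0 < M + 1 := by linarith [hφ.nonneg one_pos, hM 1 one_pos]
  obtain ⟨μ, hμ⟩ := (hφ.const_mul (inv_nonneg.2 hpos.le)).exists_measure_unitInterval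
    fun r hr => (inv_mul_le_one₀ hpos).2 (by linarith [hM r hr])
  refine ⟨_, ((hasLaplaceTransform_map_neg_log hμ).smul ⟨M + 1, hpos.le⟩).congr fun r _ => ?_⟩
  exact mul_inv_cancel_left₀ hpos.ne' _

-- If `μ a` has transform `φ (· + a)`, uniqueness forces the measures `exp (a ω) μ a` to agree.
lemma exists_hasLaplaceTransform (hφ : IsCompletelyMonotone φ) :
    ∃ μ : Measure ℝ≥0, HasLaplaceTransform μ φ := by
  have hshift : ∀ a : ℝ, 0 < a → ∃ μ : Measure ℝ≥0, HasLaplaceTransform μ fun r => φ (r + a) :=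
    fun a ha => (hφ.comp_add_const ha.le).exists_hasLaplaceTransform_of_le fun r hr =>
      hφ.antitoneOn ha (add_pos hr ha) (le_add_of_nonneg_left hr.le)
  choose! μ hμ using hshift
  refine ⟨expWeight (-1) (μ 1), fun r hr => ?_⟩
  obtain ⟨a, ha, har⟩ := exists_between (lt_min hr one_pos)
  have hμ₁ : μ 1 = expWeight (1 - a) (μ a) :=
    (hμ 1 one_pos).unique <| ((hμ a ha).expWeight (by linarith [min_le_right r 1])).congr
      fun r _ => congrArg φ (by ring)
  rw [hμ₁, expWeight_expWeight, integrable_exp_expWeight_iff, integral_exp_expWeight]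
  convert hμ a ha (r - a) (by linarith [min_le_left r 1]) using 4 <;> ring_nf

theorem existsUnique_hasLaplaceTransform (hφ : IsCompletelyMonotone φ) :
    ∃! μ : Measure ℝ≥0, HasLaplaceTransform μ φ :=
  hφ.exists_hasLaplaceTransform.elim fun μ hμ => ⟨μ, hμ, fun _ hν => hν.unique hμ⟩

end IsCompletelyMonotone

/-! ### Exponential tilting -/

section Tilting

variable {α β : Type*} [MeasurableSpace α] [MeasurableSpace β]

lemma map_tilted_comp (μ : Measure α) {g : α → β} (hg : Measurable g) {q : β → ℝ}
    (hq : Measurable q) : (μ.tilted (q ∘ g)).map g = (μ.map g).tilted q := by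
  ext s hs
  have hexp : AEStronglyMeasurable (fun b => Real.exp (q b)) (μ.map g) :=
    hq.exp.aestronglyMeasurable
  rw [Measure.map_apply hg hs, tilted_apply' _ _ (hg hs), tilted_apply' _ _ hs,
    setLIntegral_map hs (by fun_prop) hg, integral_map hg.aemeasurable hexp]
  rfl

lemma map_swap_tilted_prod (μ : Measure α) (ν : Measure β) [SFinite μ] [SFinite ν] {q : α × β → ℝ}
    (hq : Measurable q) :
    ((μ.prod ν).tilted q).map Prod.swap = (ν.prod μ).tilted (q ∘ Prod.swap) := by
  rw [← Measure.prod_swap (μ := μ) (ν := ν),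
    ← map_tilted_comp _ measurable_swap (hq.comp measurable_swap)]
  rfl

lemma tilted_const_add (μ : Measure α) (c : ℝ) (q : α → ℝ) :
    (μ.tilted fun x => c + q x) = μ.tilted q := by
  simp_rw [Measure.tilted, Real.exp_add, integral_const_mul,
    mul_div_mul_left _ _ (Real.exp_pos c).ne']

lemma pi_tilted {ι : Type*} [Fintype ι] {α : ι → Type*} [∀ i, MeasurableSpace (α i)]
    (μ : ∀ i, Measure (α i)) [∀ i, SigmaFinite (μ i)] (q : ∀ i, α i → ℝ) :
    Measure.pi (fun i => (μ i).tilted (q i)) =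
      (Measure.pi μ).tilted fun x => ∑ i, q i (x i) := by
  refine Measure.pi_eq fun s hs => ?_
  simp only [tilted_apply_eq_ofReal_integral' _ (hs _)]
  rw [tilted_apply_eq_ofReal_integral' _ (MeasurableSet.univ_pi hs), Measure.restrict_pi_pi]
  simp only [integral_div, Real.exp_sum]
  rw [integral_fintype_prod_eq_prod (fun i x => Real.exp (q i x)),
    integral_fintype_prod_eq_prod (fun i x => Real.exp (q i x)), ← Finset.prod_div_distrib]
  refine ENNReal.ofReal_prod_of_nonneg fun i _ => div_nonneg ?_ ?_ <;>
    exact integral_nonneg fun _ => (Real.exp_pos _).le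

lemma inv_measure_univ_smul_withDensity_exp (μ : Measure α) {q : α → ℝ} (hq : Measurable q) :
    (μ.withDensity (fun x => ENNReal.ofReal (Real.exp (q x))) Set.univ)⁻¹ •
      μ.withDensity (fun x => ENNReal.ofReal (Real.exp (q x))) = μ.tilted q := by
  rw [withDensity_apply _ MeasurableSet.univ, Measure.restrict_univ]
  by_cases hint : Integrable (fun x => Real.exp (q x)) μ
  · rcases eq_zero_or_neZero μ with rfl | _
    · simp
    have hpos := integral_exp_pos hint
    rw [← ofReal_integral_eq_lintegral_ofReal hint
        (Eventually.of_forall fun _ => (Real.exp_pos _).le), Measure.tilted,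
      ← withDensity_smul _ (by fun_prop)]
    congr 1 with x
    rw [Pi.smul_apply, smul_eq_mul, ENNReal.ofReal_div_of_pos hpos, div_eq_mul_inv, mul_comm]
  · have htop : ∫⁻ x, ENNReal.ofReal (Real.exp (q x)) ∂μ = ⊤ := by
      by_contra h
      exact hint ((lintegral_ofReal_ne_top_iff_integrable hq.exp.aestronglyMeasurable
        (Eventually.of_forall fun _ => (Real.exp_pos _).le)).1 h)
    rw [htop, ENNReal.inv_top, zero_smul, tilted_of_not_integrable hint]

lemma fst_withDensity_prod (μ : Measure α) (ν : Measure β) [SFinite μ] [SFinite ν]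
    {D : α × β → ℝ≥0∞} (hD : Measurable D) :
    ((μ.prod ν).withDensity D).fst = μ.withDensity fun a => ∫⁻ b, D (a, b) ∂ν := by
  ext s hs
  rw [Measure.fst_apply hs, withDensity_apply _ (measurable_fst hs), withDensity_apply _ hs,
    ← Set.prod_univ, setLIntegral_prod _ hD.aemeasurable]
  simp

/-- The kernel `a ↦ ν.tilted (q (a, ·))`, for measurable `q`: in a Bayesian model with prior `ν` and
log-likelihood `q`, the posterior as a function of the data. -/
noncomputable def tiltedKernel (ν : Measure β) [SFinite ν] (q : α × β → ℝ) : Kernel α β :=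
  (Kernel.const α ν).withDensity fun a b =>
    ENNReal.ofReal (Real.exp (q (a, b)) / ∫ b', Real.exp (q (a, b')) ∂ν)

lemma measurable_exp_div_integral_exp (ν : Measure β) [SFinite ν] {q : α × β → ℝ}
    (hq : Measurable q) :
    Measurable fun p : α × β => ENNReal.ofReal (Real.exp (q p) / ∫ b, Real.exp (q (p.1, b)) ∂ν) :=
  (hq.exp.div (hq.exp.stronglyMeasurable.integral_prod_right'.measurable.comp
    measurable_fst)).ennreal_ofReal

lemma tiltedKernel_apply (ν : Measure β) [SFinite ν] {q : α × β → ℝ} (hq : Measurable q) (a : α) :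
    tiltedKernel ν q a = ν.tilted fun b => q (a, b) := by
  rw [tiltedKernel, Kernel.withDensity_apply _ (measurable_exp_div_integral_exp ν hq),
    Kernel.const_apply, Measure.tilted]

lemma isCondKernel_tiltedKernel (μ : Measure α) (ν : Measure β) [SFinite μ] [SFinite ν]
    {q : α × β → ℝ} (hq : Measurable q) :
    ((μ.prod ν).tilted q).IsCondKernel (tiltedKernel ν q) where
  disintegrate := by
    by_cases hint : Integrable (fun p => Real.exp (q p)) (μ.prod ν)
    swap
    · simp [tilted_of_not_integrable hint]
    rcases eq_zero_or_neZero ν with rfl | _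
    · simp
    let D : α × β → ℝ≥0∞ := fun p =>
      ENNReal.ofReal (Real.exp (q p) / ∫ p', Real.exp (q p') ∂μ.prod ν)
    let k : α × β → ℝ≥0∞ := fun p =>
      ENNReal.ofReal (Real.exp (q p) / ∫ b, Real.exp (q (p.1, b)) ∂ν)
    have hD : Measurable D := by fun_prop
    have hk : Measurable k := measurable_exp_div_integral_exp ν hq
    have hfst : Measurable fun a => ∫⁻ b, D (a, b) ∂ν := hD.lintegral_prod_right'
    have : IsSFiniteKernel ((Kernel.const α ν).withDensity fun a b => k (a, b)) :=
      Kernel.IsSFiniteKernel.withDensity _ fun _ _ => ENNReal.ofReal_ne_top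
    calc ((μ.prod ν).tilted q).fst ⊗ₘ tiltedKernel ν q
        = ((μ.withDensity fun a => ∫⁻ b, D (a, b) ∂ν).prod ν).withDensity k := by
          rw [Measure.tilted, fst_withDensity_prod _ _ hD, ← Measure.compProd_const]
          exact Measure.compProd_withDensity hk
      _ = (μ.prod ν).withDensity ((fun p => ∫⁻ b, D (p.1, b) ∂ν) * k) := by
          rw [prod_withDensity_left hfst]
          exact (withDensity_mul _ (hfst.comp measurable_fst) hk).symm
      _ = (μ.prod ν).tilted q := by
          refine withDensity_congr_ae ?_
          filter_upwards [Measure.quasiMeasurePreserving_fst.ae hint.prod_right_ae] with p hp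
          have hpos := integral_exp_pos hp
          rw [Pi.mul_apply, ← ofReal_integral_eq_lintegral_ofReal (hp.div_const _)
              (Eventually.of_forall fun _ => by positivity), integral_div,
            ← ENNReal.ofReal_mul (by positivity)]
          congr 1
          field_simp

end Tilting

/-! ### Tilting Gaussian measures by concave quadratic functions -/

lemma tilted_prod_fst {α β : Type*} [MeasurableSpace α] [MeasurableSpace β] (μ : Measure α)
    [SFinite μ] (ν : Measure β) [IsProbabilityMeasure ν] {q : α → ℝ} (hq : Measurable q) :
    (μ.prod ν).tilted (fun p => q p.1) = (μ.tilted q).prod ν := by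
  have hint : ∫ p : α × β, Real.exp (q p.1) ∂μ.prod ν = ∫ x, Real.exp (q x) ∂μ := by
    simpa using integral_prod_mul (μ := μ) (ν := ν) (fun x => Real.exp (q x)) fun _ => (1 : ℝ)
  rw [Measure.tilted, Measure.tilted, prod_withDensity_left (by fun_prop), hint]

lemma exists_gaussianPDFReal_mul_exp_quadratic (m : ℝ) {v : ℝ≥0} (hv : v ≠ 0) (a : ℝ≥0) (b : ℝ) :
    ∃ K > 0, ∀ x, gaussianPDFReal m v x * Real.exp (-a * x ^ 2 + b * x) =
      K * gaussianPDFReal ((m + b * v) / (1 + 2 * a * v)) (v / (1 + 2 * a * v)) x := by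
  set m' : ℝ := (m + b * v) / (1 + 2 * a * v) with hm'
  set v' : ℝ≥0 := v / (1 + 2 * a * v) with hv'
  have hv'_pos : 0 < v' := by positivity
  have hcoe : (v' : ℝ) = v / (1 + 2 * a * v) := by rw [hv']; push_cast; rfl
  refine ⟨(√(2 * Real.pi * v))⁻¹ * √(2 * Real.pi * v') *
    Real.exp (m' ^ 2 / (2 * v') - m ^ 2 / (2 * v)), by positivity, fun x => ?_⟩
  have hsquare : -(x - m) ^ 2 / (2 * v) + (-a * x ^ 2 + b * x) =
      m' ^ 2 / (2 * v') - m ^ 2 / (2 * v) + -(x - m') ^ 2 / (2 * v') := by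
    rw [hcoe, hm']
    field_simp
    ring
  rw [gaussianPDFReal, gaussianPDFReal, mul_assoc, ← Real.exp_add, hsquare, Real.exp_add]
  field_simp

lemma gaussianReal_tilted_quadratic (m : ℝ) (v a : ℝ≥0) (b : ℝ) :
    (gaussianReal m v).tilted (fun x => -a * x ^ 2 + b * x) =
      gaussianReal ((m + b * v) / (1 + 2 * a * v)) (v / (1 + 2 * a * v)) := by
  rcases eq_or_ne v 0 with rfl | hv
  · have hconst : (fun x => -a * x ^ 2 + b * x) =ᵐ[Measure.dirac m]
        fun _ => -a * m ^ 2 + b * m := by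
      rw [Filter.EventuallyEq, ae_dirac_eq]
      rfl
    rw [gaussianReal_zero_var, tilted_congr hconst, tilted_const]
    simp
  have hv' : v / (1 + 2 * a * v) ≠ 0 := by positivity
  obtain ⟨K, hK, hpdf⟩ := exists_gaussianPDFReal_mul_exp_quadratic m hv a b
  have hint : ∫ x, Real.exp (-a * x ^ 2 + b * x) ∂gaussianReal m v = K := by
    simp_rw [integral_gaussianReal_eq_integral_smul hv, smul_eq_mul, hpdf]
    rw [integral_const_mul, integral_gaussianPDFReal_eq_one _ hv', mul_one]
  rw [Measure.tilted, hint, gaussianReal_of_var_ne_zero _ hv, gaussianReal_of_var_ne_zero _ hv',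
    ← withDensity_mul _ (measurable_gaussianPDF m v) (by fun_prop)]
  congr 1
  ext x
  rw [Pi.mul_apply, gaussianPDF, gaussianPDF, ← ENNReal.ofReal_mul (gaussianPDFReal_nonneg _ _ _),
    mul_div_assoc', hpdf, mul_div_cancel_left₀ _ hK.ne']

-- Regression of `M` on `L`: for jointly Gaussian variables, uncorrelated means independent.
lemma exists_indepFun_sub_smul {E : Type*} [NormedAddCommGroup E] [NormedSpace ℝ E]
    [MeasurableSpace E] [BorelSpace E] [SecondCountableTopology E] (μ : Measure E) [IsGaussian μ]
    (L M : StrongDual ℝ E) :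
    ∃ c : ℝ, IndepFun L (M - c • L : StrongDual ℝ E) μ := by
  have hL : MemLp L 2 μ := IsGaussian.memLp_dual μ L 2 (by simp)
  have hM : MemLp M 2 μ := IsGaussian.memLp_dual μ M 2 (by simp)
  by_cases hvar : Var[L; μ] = 0
  · have hconst : L =ᵐ[μ] fun _ => ∫ x, L x ∂μ := ae_eq_integral_of_variance_eq_zero hL hvar
    exact ⟨0, (indepFun_const_left _ _).congr hconst.symm (ae_eq_refl _)⟩
  refine ⟨cov[L, M; μ] / Var[L; μ], ?_⟩
  set c := cov[L, M; μ] / Var[L; μ] with hc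
  have hpair : HasGaussianLaw (fun x => (L x, (M - c • L : StrongDual ℝ E) x)) μ :=
    (IsGaussian.hasGaussianLaw_id (μ := μ)).map_fun (L.prod (M - c • L))
  refine hpair.indepFun_of_covariance_eq_zero ?_
  change cov[L, (M : E → ℝ) - c • (L : E → ℝ); μ] = 0
  rw [covariance_sub_right hL hM (hL.const_smul _), covariance_smul_right,
    covariance_self hL.aemeasurable, hc, div_mul_cancel₀ _ hvar, sub_self]

/-- Tilting by `q` maps Gaussian measures (degenerate ones included) to Gaussian measures: `q` is a
log-likelihood for which Gaussian priors are conjugate. -/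
def PreservesGaussian {E : Type*} [NormedAddCommGroup E] [NormedSpace ℝ E] [MeasurableSpace E]
    (q : E → ℝ) : Prop :=
  ∀ (μ : Measure E) [IsGaussian μ], IsGaussian (μ.tilted q)

namespace PreservesGaussian

section Algebra

variable {E : Type*} [NormedAddCommGroup E] [NormedSpace ℝ E] [MeasurableSpace E] {q q' : E → ℝ}

lemma integrable_exp (hq : PreservesGaussian q) (μ : Measure E) [IsGaussian μ] :
    Integrable (fun x => Real.exp (q x)) μ := by
  by_contra h
  have := hq μ
  exact IsProbabilityMeasure.ne_zero (μ.tilted q) (tilted_of_not_integrable h)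

lemma add (hq : PreservesGaussian q) (hq' : PreservesGaussian q') :
    PreservesGaussian fun x => q x + q' x := by
  intro μ _
  have := hq μ
  have h := hq' (μ.tilted q)
  rwa [tilted_tilted (hq.integrable_exp μ)] at h

lemma const (c : ℝ) : PreservesGaussian fun _ : E => c := by
  intro μ _
  rw [tilted_const]
  infer_instance

lemma sum {ι : Type*} (s : Finset ι) {q : ι → E → ℝ} (hq : ∀ i, PreservesGaussian (q i)) :
    PreservesGaussian fun x => ∑ i ∈ s, q i x := by
  classical
  induction s using Finset.induction_on with
  | empty => simpa using const (E := E) 0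
  | insert i s hi ih =>
    simp_rw [Finset.sum_insert hi]
    exact (hq i).add ih

end Algebra

variable {E : Type*} [NormedAddCommGroup E] [NormedSpace ℝ E] [MeasurableSpace E] [BorelSpace E]
  [SecondCountableTopology E]

lemma comp_dual {q : ℝ → ℝ} (hq : PreservesGaussian q) (hqm : Measurable q) (L : StrongDual ℝ E) :
    PreservesGaussian (q ∘ L) := by
  intro μ _
  refine isGaussian_of_isGaussian_map fun M => ?_
  obtain ⟨c, hind⟩ := exists_indepFun_sub_smul μ L M
  set N : StrongDual ℝ E := M - c • L with hN_def
  have hL : Measurable L := L.continuous.measurable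
  have hN : Measurable N := N.continuous.measurable
  have hpair : (μ.tilted (q ∘ L)).map (fun x => (L x, N x)) =
      ((μ.map L).tilted q).prod (μ.map N) := by
    rw [← tilted_prod_fst _ _ hqm,
      ← (indepFun_iff_map_prod_eq_prod_map_map hL.aemeasurable hN.aemeasurable).1 hind]
    exact map_tilted_comp μ (q := fun p : ℝ × ℝ => q p.1) (hL.prodMk hN)
      (hqm.comp measurable_fst)
  have hfst : IsGaussian ((μ.map L).tilted q) := hq _
  let S : ℝ × ℝ →L[ℝ] ℝ := c • ContinuousLinearMap.fst ℝ ℝ ℝ + ContinuousLinearMap.snd ℝ ℝ ℝ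
  have hM : ⇑M = S ∘ fun x => (L x, N x) := by
    ext x
    simp [S, hN_def]
  rw [hM, ← Measure.map_map S.continuous.measurable (hL.prodMk hN), hpair]
  infer_instance

lemma quadratic (L : StrongDual ℝ E) (a : ℝ≥0) (b : ℝ) :
    PreservesGaussian fun x => -a * L x ^ 2 + b * L x := by
  have hreal : PreservesGaussian fun t : ℝ => -a * t ^ 2 + b * t := by
    intro μ hμ
    rw [IsGaussian.eq_gaussianReal μ hμ, gaussianReal_tilted_quadratic]
    infer_instance
  exact hreal.comp_dual (by fun_prop) L

lemma dual (L : StrongDual ℝ E) : PreservesGaussian L := by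
  simpa using quadratic L 0 1

lemma neg_mul_sq (L : StrongDual ℝ E) (a : ℝ≥0) (b : ℝ) :
    PreservesGaussian fun x => -a * (L x + b) ^ 2 := by
  convert (quadratic L a (-(2 * a * b))).add (const (-a * b ^ 2)) using 2
  ring

lemma neg_mul_norm_sq {ι : Type*} [Fintype ι] {h : E →ᵃ[ℝ] EuclideanSpace ℝ ι}
    (hc : Continuous h) (a : ℝ≥0) : PreservesGaussian fun x => -a * ‖h x‖ ^ 2 := by
  let A : E →L[ℝ] EuclideanSpace ℝ ι := ⟨h.linear, h.continuous_linear_iff.2 hc⟩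
  have hA (x : E) : h x = A x + h 0 := congrFun h.decomp x
  convert sum (E := E) Finset.univ fun j : ι =>
    neg_mul_sq ((EuclideanSpace.proj j : _ →L[ℝ] ℝ).comp A) a (h 0 j) using 2 with x
  rw [EuclideanSpace.norm_sq_eq, Finset.mul_sum]
  refine Finset.sum_congr rfl fun j _ => ?_
  rw [hA x]
  simp

end PreservesGaussian

/-! ### The augmented model -/

namespace IsPDR

variable {φ : ℝ → ℝ}

lemma isCompletelyMonotone (hφ : IsPDR φ) : IsCompletelyMonotone φ :=
  ⟨hφ.contDiffOn, hφ.alternating⟩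

lemma hasLaplaceTransform_piPhi_zero (hφ : IsPDR φ) : HasLaplaceTransform (piPhi φ 0) φ := by
  have hex := hφ.isCompletelyMonotone.exists_hasLaplaceTransform
  have hzero : piPhi φ 0 = inverseLaplace φ := by simp [piPhi, hφ.map_zero]
  rw [hzero, inverseLaplace, dif_pos hex]
  exact hex.choose_spec

lemma isProbabilityMeasure_piPhi_zero (hφ : IsPDR φ) : IsProbabilityMeasure (piPhi φ 0) :=
  ⟨by simpa using hφ.hasLaplaceTransform_piPhi_zero.measure_univ_eq hφ.tendsto_zero⟩

lemma integrable_exp_piPhi_zero (hφ : IsPDR φ) {r : ℝ} (hr : 0 ≤ r) :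
    Integrable (fun w : ℝ≥0 => Real.exp (-(r * w))) (piPhi φ 0) := by
  have := hφ.isProbabilityMeasure_piPhi_zero
  rcases hr.eq_or_lt with rfl | hr
  · simp
  · exact (hφ.hasLaplaceTransform_piPhi_zero r hr).1

lemma integral_exp_piPhi_zero (hφ : IsPDR φ) {r : ℝ} (hr : 0 ≤ r) :
    ∫ w : ℝ≥0, Real.exp (-(r * w)) ∂piPhi φ 0 = φ r := by
  have := hφ.isProbabilityMeasure_piPhi_zero
  rcases hr.eq_or_lt with rfl | hr
  · simp [hφ.map_zero]
  · exact (hφ.hasLaplaceTransform_piPhi_zero r hr).2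

lemma piPhi_eq_tilted (hφ : IsPDR φ) (c : ℝ) :
    piPhi φ c = (piPhi φ 0).tilted fun w => -(c ^ 2 * (w : ℝ)) := by
  rw [Measure.tilted, hφ.integral_exp_piPhi_zero (sq_nonneg c)]
  simp [piPhi, hφ.map_zero]

lemma isProbabilityMeasure_piPhi (hφ : IsPDR φ) (c : ℝ) : IsProbabilityMeasure (piPhi φ c) := by
  have := hφ.isProbabilityMeasure_piPhi_zero
  rw [hφ.piPhi_eq_tilted]
  exact isProbabilityMeasure_tilted (hφ.integrable_exp_piPhi_zero (sq_nonneg c))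

lemma isProbabilityMeasure_auxPrior (hφ : IsPDR φ) (ι : Type*) [Fintype ι] :
    IsProbabilityMeasure (auxPrior ι φ) := by
  have := hφ.isProbabilityMeasure_piPhi_zero
  rw [auxPrior]
  infer_instance

end IsPDR

namespace SuperGaussianLikelihood

variable {𝒴 κ : Type*} [Fintype κ] (L : SuperGaussianLikelihood 𝒴 κ) (y : 𝒴)

/-- The augmented log-likelihood `log p(y | f, ω)` of one observation. -/
noncomputable def logAugLik (f : EuclideanSpace ℝ κ) (w : ℝ≥0) : ℝ :=
  Real.log L.C + inner ℝ (L.g y) f + -(‖L.h y f‖ ^ 2 * w)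

lemma exp_logAugLik (f : EuclideanSpace ℝ κ) (w : ℝ≥0) :
    Real.exp (L.logAugLik y f w) = L.augLik y f w := by
  rw [logAugLik, add_assoc, Real.exp_add, Real.exp_log L.C_pos, ← sub_eq_add_neg, augLik]

lemma augLik_eq_mul_exp (f : EuclideanSpace ℝ κ) (w : ℝ≥0) :
    L.augLik y f w = L.C * Real.exp (inner ℝ (L.g y) f) * Real.exp (-(‖L.h y f‖ ^ 2 * w)) := by
  rw [augLik, sub_eq_add_neg, Real.exp_add, mul_assoc]

lemma integrable_augLik (f : EuclideanSpace ℝ κ) : Integrable (L.augLik y f) (piPhi L.φ 0) := by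
  simp_rw [funext (L.augLik_eq_mul_exp y f)]
  exact (L.isPDR.integrable_exp_piPhi_zero (sq_nonneg _)).const_mul _

lemma lik_eq_integral (f : EuclideanSpace ℝ κ) :
    L.lik y f = ∫ w, L.augLik y f w ∂piPhi L.φ 0 := by
  simp_rw [augLik_eq_mul_exp]
  rw [integral_const_mul, L.isPDR.integral_exp_piPhi_zero (sq_nonneg _), lik]

lemma piPhi_zero_tilted_logAugLik (f : EuclideanSpace ℝ κ) :
    (piPhi L.φ 0).tilted (L.logAugLik y f) = piPhi L.φ ‖L.h y f‖ := by
  rw [L.isPDR.piPhi_eq_tilted ‖L.h y f‖]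
  exact tilted_const_add _ _ fun w : ℝ≥0 => -(‖L.h y f‖ ^ 2 * w)

lemma continuous_h : Continuous (L.h y) := (L.h y).continuous_of_finiteDimensional

lemma continuous_logAugLik :
    Continuous fun p : EuclideanSpace ℝ κ × ℝ≥0 => L.logAugLik y p.1 p.2 := by
  have := L.continuous_h y
  unfold logAugLik
  fun_prop

lemma logAugLik_le_logAugLik_zero (f : EuclideanSpace ℝ κ) (w : ℝ≥0) :
    L.logAugLik y f w ≤ L.logAugLik y f 0 := by
  simpa [logAugLik] using by positivity

end SuperGaussianLikelihood

/-- `block` as a continuous linear map. -/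
noncomputable def blockCLM {ι κ : Type*} (i : ι) :
    EuclideanSpace ℝ (ι × κ) →L[ℝ] EuclideanSpace ℝ κ where
  toFun f := block f i
  map_add' _ _ := rfl
  map_smul' _ _ := rfl
  cont := by
    unfold block
    fun_prop

lemma isGaussian_gpPrior {ι κ T Ω : Type*} [Finite ι] [Finite κ] [MeasurableSpace Ω]
    {F : T → Ω → ℝ} {P : Measure Ω} (hF : IsGaussianProcess F P) (x : ι × κ → T) :
    IsGaussian (gpPrior F P x) := by
  have := Fintype.ofFinite ι
  have := Fintype.ofFinite κ
  have h := (hF.comp_right x).hasGaussianLaw Finset.univ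
  let A : (((Finset.univ : Finset (ι × κ)) : Type _) → ℝ) →L[ℝ] EuclideanSpace ℝ (ι × κ) :=
    ((PiLp.continuousLinearEquiv 2 ℝ fun _ : ι × κ => ℝ).symm : _ →L[ℝ] _).comp
      (ContinuousLinearMap.pi fun j => ContinuousLinearMap.proj ⟨j, Finset.mem_univ j⟩)
  exact (h.map_fun A).isGaussian_map

section Model

variable {𝒴 ι κ : Type*} [Fintype ι] [Fintype κ] (L : SuperGaussianLikelihood 𝒴 κ) (y : ι → 𝒴)

/-- The augmented log-likelihood `log p(y | f, ω)` of all observations. -/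
noncomputable def fullLogAugLik (f : EuclideanSpace ℝ (ι × κ)) (w : ι → ℝ≥0) : ℝ :=
  ∑ i, L.logAugLik (y i) (block f i) (w i)

lemma exp_fullLogAugLik (f : EuclideanSpace ℝ (ι × κ)) (w : ι → ℝ≥0) :
    Real.exp (fullLogAugLik L y f w) = fullAugLik L y f w := by
  simp_rw [fullLogAugLik, Real.exp_sum, L.exp_logAugLik, fullAugLik]

lemma measurable_fullLogAugLik :
    Measurable fun p : EuclideanSpace ℝ (ι × κ) × (ι → ℝ≥0) => fullLogAugLik L y p.1 p.2 := by
  refine (continuous_finsetSum _ fun i _ => ?_).measurable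
  exact (L.continuous_logAugLik (y i)).comp <|
    ((blockCLM i).continuous.comp continuous_fst).prodMk
      ((continuous_apply i).comp continuous_snd)

lemma integrable_fullAugLik (f : EuclideanSpace ℝ (ι × κ)) :
    Integrable (fullAugLik L y f) (auxPrior ι L.φ) := by
  have := L.isPDR.isProbabilityMeasure_piPhi_zero
  exact Integrable.fintype_prod_dep fun i => L.integrable_augLik (y i) (block f i)

lemma fullLik_eq_integral (f : EuclideanSpace ℝ (ι × κ)) :
    fullLik L y f = ∫ w, fullAugLik L y f w ∂auxPrior ι L.φ := by
  have := L.isPDR.isProbabilityMeasure_piPhi_zero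
  unfold fullLik fullAugLik auxPrior
  rw [integral_fintype_prod_eq_prod fun i w => L.augLik (y i) (block f i) w]
  exact Finset.prod_congr rfl fun i _ => L.lik_eq_integral _ _

lemma augJoint_fst (prior : Measure (EuclideanSpace ℝ (ι × κ))) [SFinite prior] :
    (augJoint L prior y).fst = modelJoint L prior y := by
  have := L.isPDR.isProbabilityMeasure_auxPrior ι
  have hD : Measurable fun p : EuclideanSpace ℝ (ι × κ) × (ι → ℝ≥0) =>
      ENNReal.ofReal (fullAugLik L y p.1 p.2) := by
    simp_rw [← exp_fullLogAugLik]
    exact (measurable_fullLogAugLik L y).exp.ennreal_ofReal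
  rw [augJoint, fst_withDensity_prod _ _ hD, modelJoint]
  congr 1 with f
  rw [fullLik_eq_integral, ofReal_integral_eq_lintegral_ofReal (integrable_fullAugLik L y f)]
  exact Eventually.of_forall fun w => exp_fullLogAugLik L y f w ▸ (Real.exp_pos _).le

lemma augPosterior_eq_tilted (prior : Measure (EuclideanSpace ℝ (ι × κ))) :
    augPosterior L prior y =
      (prior.prod (auxPrior ι L.φ)).tilted fun p => fullLogAugLik L y p.1 p.2 := by
  simp_rw [augPosterior, augJoint, ← exp_fullLogAugLik]
  exact inv_measure_univ_smul_withDensity_exp _ (measurable_fullLogAugLik L y)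

lemma exists_eq_pi_piPhi_isCondKernel_augPosterior
    (prior : Measure (EuclideanSpace ℝ (ι × κ))) [SFinite prior] :
    ∃ κω : Kernel (EuclideanSpace ℝ (ι × κ)) (ι → ℝ≥0),
      (∀ f, κω f = Measure.pi fun i => piPhi L.φ ‖L.h (y i) (block f i)‖) ∧
      (augPosterior L prior y).IsCondKernel κω := by
  have := L.isPDR.isProbabilityMeasure_piPhi_zero
  have := L.isPDR.isProbabilityMeasure_auxPrior ι
  have hmeas := measurable_fullLogAugLik L y
  refine ⟨tiltedKernel (auxPrior ι L.φ) fun p => fullLogAugLik L y p.1 p.2, fun f => ?_,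
    augPosterior_eq_tilted L y prior ▸ isCondKernel_tiltedKernel _ _ hmeas⟩
  simp_rw [tiltedKernel_apply _ hmeas, ← L.piPhi_zero_tilted_logAugLik, pi_tilted]
  rfl

lemma preservesGaussian_fullLogAugLik (w : ι → ℝ≥0) :
    PreservesGaussian fun f => fullLogAugLik L y f w := by
  refine PreservesGaussian.sum _ fun i => ?_
  have hinner : PreservesGaussian fun f => inner ℝ (L.g (y i)) (block f i) :=
    .dual ((innerSL ℝ (L.g (y i))).comp (blockCLM i))
  have hnorm : PreservesGaussian fun f => -(w i : ℝ) * ‖L.h (y i) (block f i)‖ ^ 2 :=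
    .neg_mul_norm_sq (h := (L.h (y i)).comp (blockCLM i).toLinearMap.toAffineMap)
      ((L.continuous_h (y i)).comp (blockCLM i).continuous) (w i)
  simpa only [SuperGaussianLikelihood.logAugLik, neg_mul, mul_comm (w i : ℝ)] using
    ((PreservesGaussian.const _).add hinner).add hnorm

variable (prior : Measure (EuclideanSpace ℝ (ι × κ))) [IsGaussian prior]

-- For `w = 0` the augmented log-likelihood is affine in `f`, and this is the worst case.
lemma integrable_exp_fullLogAugLik :
    Integrable (fun p => Real.exp (fullLogAugLik L y p.1 p.2)) (prior.prod (auxPrior ι L.φ)) := by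
  have := L.isPDR.isProbabilityMeasure_auxPrior ι
  refine (((preservesGaussian_fullLogAugLik L y 0).integrable_exp prior).comp_fst
    (auxPrior ι L.φ)).mono' (measurable_fullLogAugLik L y).exp.aestronglyMeasurable
    (Eventually.of_forall fun p => ?_)
  rw [Real.norm_of_nonneg (Real.exp_pos _).le, Real.exp_le_exp]
  exact Finset.sum_le_sum fun i _ => L.logAugLik_le_logAugLik_zero _ _ _

lemma isProbabilityMeasure_augPosterior : IsProbabilityMeasure (augPosterior L prior y) := by
  have := L.isPDR.isProbabilityMeasure_auxPrior ι
  rw [augPosterior_eq_tilted]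
  exact isProbabilityMeasure_tilted (integrable_exp_fullLogAugLik L y prior)

lemma exists_isGaussian_isCondKernel_map_swap_augPosterior :
    ∃ κf : Kernel (ι → ℝ≥0) (EuclideanSpace ℝ (ι × κ)),
      (∀ w, IsGaussian (κf w)) ∧ ((augPosterior L prior y).map Prod.swap).IsCondKernel κf := by
  have := L.isPDR.isProbabilityMeasure_auxPrior ι
  have hmeas := measurable_fullLogAugLik L y
  refine ⟨tiltedKernel prior ((fun p => fullLogAugLik L y p.1 p.2) ∘ Prod.swap), fun w => ?_, ?_⟩
  · rw [tiltedKernel_apply _ (hmeas.comp measurable_swap)]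
    exact preservesGaussian_fullLogAugLik L y w prior
  · rw [augPosterior_eq_tilted, map_swap_tilted_prod _ _ hmeas]
    exact isCondKernel_tiltedKernel _ _ (hmeas.comp measurable_swap)

end Model

theorem theorem1 {𝒴 ι κ T Ω : Type*} [Fintype ι] [Fintype κ] [MeasurableSpace Ω]
    -- a super-Gaussian likelihood, a Gaussian process, inputs and observations
    (L : SuperGaussianLikelihood 𝒴 κ)
    (F : T → Ω → ℝ) (P : Measure Ω) (hF : IsGaussianProcess F P)
    (x : ι × κ → T) (y : ι → 𝒴) :
    -- the inverse Laplace transform of `φ` exists and is unique, it is `π_φ(· | 0)`,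
    -- and the whole family `π_φ(· | c)` consists of probability measures
    (∃! μ : Measure ℝ≥0, HasLaplaceTransform μ L.φ) ∧
    HasLaplaceTransform (piPhi L.φ 0) L.φ ∧
    (∀ c : ℝ, IsProbabilityMeasure (piPhi L.φ c)) ∧
    -- every likelihood factor is a scale mixture of the augmented likelihood
    (∀ (y₀ : 𝒴) (f₀ : EuclideanSpace ℝ κ),
      Integrable (fun w => L.augLik y₀ f₀ w) (piPhi L.φ 0) ∧
      L.lik y₀ f₀ = ∫ w, L.augLik y₀ f₀ w ∂(piPhi L.φ 0)) ∧
    -- and so is the likelihood of all the data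
    (∀ f : EuclideanSpace ℝ (ι × κ),
      Integrable (fun w => fullAugLik L y f w) (auxPrior ι L.φ) ∧
      fullLik L y f = ∫ w, fullAugLik L y f w ∂(auxPrior ι L.φ)) ∧
    -- integrating `ω` out of the augmented model gives back the original model
    (augJoint L (gpPrior F P x) y).fst = modelJoint L (gpPrior F P x) y ∧
    -- the posterior of the augmented model is well defined
    IsProbabilityMeasure (augPosterior L (gpPrior F P x) y) ∧
    -- conditional conjugacy in `f`: prior and complete conditional `p(f | ω, y)` are Gaussian
    IsGaussian (gpPrior F P x) ∧
    (∃ κf : Kernel (ι → ℝ≥0) (EuclideanSpace ℝ (ι × κ)),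
      (∀ w, IsGaussian (κf w)) ∧
      ((augPosterior L (gpPrior F P x) y).map Prod.swap).IsCondKernel κf) ∧
    -- conditional conjugacy in `ω`: the complete conditional `p(ω | f, y)` is the product of
    -- the exponential tiltings `π_φ(ωᵢ | ‖h(fᵢ, yᵢ)‖)` of the priors `π_φ(ωᵢ | 0)`
    (∃ κω : Kernel (EuclideanSpace ℝ (ι × κ)) (ι → ℝ≥0),
      (∀ f, κω f = Measure.pi (fun i => piPhi L.φ ‖L.h (y i) (block f i)‖)) ∧
      (augPosterior L (gpPrior F P x) y).IsCondKernel κω) := by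
  have hG := isGaussian_gpPrior hF x
  exact ⟨L.isPDR.isCompletelyMonotone.existsUnique_hasLaplaceTransform,
    L.isPDR.hasLaplaceTransform_piPhi_zero, L.isPDR.isProbabilityMeasure_piPhi,
    fun y₀ f₀ => ⟨L.integrable_augLik y₀ f₀, L.lik_eq_integral y₀ f₀⟩,
    fun f => ⟨integrable_fullAugLik L y f, fullLik_eq_integral L y f⟩,
    augJoint_fst L y _, isProbabilityMeasure_augPosterior L y _, hG,
    exists_isGaussian_isCondKernel_map_swap_augPosterior L y _,
    exists_eq_pi_piPhi_isCondKernel_augPosterior L y _⟩
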